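/- An instance of Unique Games consists of a finite simple graph $G=(V,E)$ with $n=|V|$ vertices, a set of $k$ labels $[k]$, and, for every edge $(u,v)\in E$ (each edge listed once, in a fixed orientation), a permutation $\pi_{uv}$ of $[k]$; an assignment $x:V\to[k]$ satisfies the edge $(u,v)$ if $x_v=\pi_{uv}(x_u)$. The instance is $\alpha$-satisfiable if some assignment satisfies at least $\alpha|E|$ edges. Its SDP value is the minimum of $$\frac1{2|E|}\sum_{(u,v)\in E}\sum_{i\in[k]}\|u_i-v_{\pi_{uv}(i)}\|^2$$ over all families of vectors $u_i$ ($u\in V$, $i\in[k]$) in Euclidean spaces $\mathbb R^d$ of any dimension such that $\sum_{i}\|u_i\|^2=1$ for all $u$; $\langle u_i,u_j\rangle=0$ for all $u$ and $i\ne j$; $\langle u_i,v_j\rangle\ge 0$ for all $u,v$ and $i\neq j$; and $\|u_i-v_j\|^2\le\|u_i-w_l\|^2+\|w_l-v_j\|^2$ for all $u,v,w\in V$, $i,j,l\in[k]$. Theorem. There exist absolute constants $k_0\in\mathbb N$ and $C>0$ and a function $\eta:\mathbb N\to\mathbb R$ with $\eta(n)\to0$ as $n\to\infty$ such that the following holds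 for all $n$, all $k\ge k_0$ and all $\varepsilon\in(0,1]$. Let $\mathcal I_0$ be an arbitrary (not necessarily satisfiable) instance of Unique Games with $k$ labels on a graph $G=(V,E)$ with $n$ vertices and at least $Cn\max(\varepsilon^{-1},\log k)$ edges, let $E_\varepsilon\subseteq E$ be an arbitrary set of exactly $\varepsilon|E|$ edges, and let $\mathcal I$ be obtained from $\mathcal I_0$ by replacing the constraints on the edges of $E_\varepsilon$ by independent uniformly random permutations of $[k]$. Then, with probability at least $1-\eta(n)$, the SDP value of $\mathcal I$ is at least $\varepsilon/32$. On the other hand, if $0\le\delta<\varepsilon/32$, then the SDP value of every $(1-\delta)$-satisfiable instance (on any graph and with any number of labels) is at most $\delta$, and hence less than $\varepsilon/32$. Consequently, comparing the SDP value with $\varepsilon/32$ distinguishes, with probability $1-o(1)$, the semi-random instances $\mathcal I$ above from arbitrary $(1-\delta)$-satisfiable instances. -/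

import Mathlib

open Filter Topology
open scoped BigOperators

noncomputable section

/-- An instance of Unique Games on the vertex set `Fin n` with label set `Fin k`: a simple
constraint graph and one permutation of the labels for every edge. Every edge `{u, v}` with
`u < v` is listed once, oriented from its smaller endpoint `u = e.inf` to its larger endpoint
`v = e.sup`, and carries the constraint `x v = π (x u)`; read from `v` to `u`, the same constraint
is given by the inverse permutation. -/
structure UniqueGame (n k : ℕ) where
  graph : SimpleGraph (Fin n)
  perm : graph.edgeSet → Equiv.Perm (Fin k)

namespace UniqueGame

variable {n k : ℕ}

/-- The number of edges `|E|`. -/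
def numEdges (I : UniqueGame n k) : ℕ := I.graph.edgeSet.ncard

/-- The assignment `x` satisfies the constraint of the edge `e`. -/
def Satisfies (I : UniqueGame n k) (x : Fin n → Fin k) (e : I.graph.edgeSet) : Prop :=
  x (e : Sym2 (Fin n)).sup = I.perm e (x (e : Sym2 (Fin n)).inf)

/-- The instance is `α`-satisfiable: some assignment satisfies at least an `α` fraction of the
constraints. -/
def IsSatisfiable (I : UniqueGame n k) (α : ℝ) : Prop :=
  ∃ x : Fin n → Fin k, α * (I.numEdges : ℝ) ≤ ({e | I.Satisfies x e}.ncard : ℝ)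

open Classical in
/-- The instance obtained from `I` by replacing the constraint of every edge `e` in `F`
by the permutation `σ e`; all other constraints are kept. -/
def corrupt (I : UniqueGame n k) (F : Finset I.graph.edgeSet)
    (σ : F → Equiv.Perm (Fin k)) : UniqueGame n k where
  graph := I.graph
  perm e := if h : e ∈ F then σ ⟨e, h⟩ else I.perm e

/-- The constraints of the standard SDP on a family of vectors `x u i`, one for every vertex `u`
and every label `i`. -/
structure IsSDPFeasible {E : Type*} [NormedAddCommGroup E] [InnerProductSpace ℝ E]
    (x : Fin n → Fin k → E) : Prop where
  sum_sq : ∀ u, ∑ i, ‖x u i‖ ^ 2 = 1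
  orthogonal : ∀ u i j, i ≠ j → inner ℝ (x u i) (x u j) = 0
  nonneg : ∀ u v i j, i ≠ j → 0 ≤ inner ℝ (x u i) (x v j)
  triangle : ∀ u v w i j l,
    ‖x u i - x v j‖ ^ 2 ≤ ‖x u i - x w l‖ ^ 2 + ‖x w l - x v j‖ ^ 2

open Classical in
/-- The objective function of the standard SDP,
`1 / (2 |E|) * ∑_{(u, v) ∈ E} ∑_i ‖u_i - v_{π_{uv}(i)}‖²`. -/
def sdpObjective {E : Type*} [NormedAddCommGroup E] [InnerProductSpace ℝ E]
    (I : UniqueGame n k) (x : Fin n → Fin k → E) : ℝ :=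
  1 / (2 * (I.numEdges : ℝ)) * ∑ e : I.graph.edgeSet, ∑ i : Fin k,
    ‖x (e : Sym2 (Fin n)).inf i - x (e : Sym2 (Fin n)).sup (I.perm e i)‖ ^ 2

/-- The optimal value of the standard SDP: the infimum of the objective over all feasible families
of vectors in Euclidean spaces of all finite dimensions. -/
def sdpValue (I : UniqueGame n k) : ℝ :=
  sInf {t | ∃ (d : ℕ) (x : Fin n → Fin k → EuclideanSpace ℝ (Fin d)),
    IsSDPFeasible x ∧ t = I.sdpObjective x}

/-- The probability that the instance has property `P` after the constraints of the edges in `F`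
have been replaced by independent, uniformly random permutations of the labels (that is, by a
uniformly random function from `F` to the permutations). -/
def probCorrupt (I : UniqueGame n k) (F : Finset I.graph.edgeSet)
    (P : UniqueGame n k → Prop) : ℝ :=
  ((PMF.uniformOfFintype (F → Equiv.Perm (Fin k))).toOuterMeasure
    {σ | P (I.corrupt F σ)}).toReal

end UniqueGame

end

/-!
The vectors of a solution of the relaxation are projected onto a Gaussian vector `g`. Layer cake
over the thresholds of the squared projections turns the correlation between the two ends of an edge
into the number of pairs of labels that the permutation of the edge matches between two superlevel
sets. If, for all families of sets of labels, the total of these numbers exceeds its mean by little,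
then the correlation along corrupted edges is, up to small errors, at most the average over the
edges `(u, v)` of `1 / k * ∑ i, ∑ j, |⟨u_i, g⟩| * |⟨v_j, g⟩|`. Because the vectors at one vertex are
orthogonal, this has expectation about `2 / π` at most, less than the value `1` that the correlation
would have if the vectors at the two ends coincided, so these vectors are far apart on average.

For a fixed family of sets, the excess of the random permutations over the mean has exponential
moments with an exponent growing like the logarithm of `k` over the size of the sets, which is what
a union bound over all families costs. Since this exponent depends on the sizes, the excess is first
bounded with weights; averaging over all ways of discarding small sets then removes the weights.

Conversely, an assignment yields vectors in dimension one whose cost is the fraction of violated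
edges.
-/

open Finset Equiv
open Real (exp log)

section RandomPermutation

variable {α : Type*} [Fintype α] [DecidableEq α]

/-- The probability that a uniformly random permutation maps the set `J` into the set `B`. -/
noncomputable def mapsToProb (J B : Finset α) : ℝ :=
  𝔼 π : Perm α, if ∀ i ∈ J, π i ∈ B then (1 : ℝ) else 0

theorem mapsToProb_insert_eq_mapsToProb_insert (J B : Finset α) {i j : α} (hi : i ∉ J)
    (hj : j ∉ J) : mapsToProb (insert i J) B = mapsToProb (insert j J) B := by
  refine Fintype.expect_equiv (Equiv.mulRight (swap i j)) _ _ fun π => ?_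
  have swap_apply_of_mem : ∀ l ∈ J, swap i j l = l := fun l hl =>
    swap_apply_of_ne_of_ne (ne_of_mem_of_not_mem hl hi) (ne_of_mem_of_not_mem hl hj)
  simp +contextual [swap_apply_of_mem]

theorem card_filter_compl_apply_mem {π : Perm α} {J B : Finset α} (h : ∀ i ∈ J, π i ∈ B) :
    (#{i ∈ Jᶜ | π i ∈ B} : ℝ) = #B - #J := by
  have preimage_eq : ({i | π i ∈ B} : Finset α) = {i ∈ Jᶜ | π i ∈ B} ∪ J := by
    ext i
    by_cases hi : i ∈ J <;> simp [hi, h]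
  have card_preimage : #{i | π i ∈ B} = #B := card_equiv π (by simp)
  have disjoint : Disjoint {i ∈ Jᶜ | π i ∈ B} J :=
    disjoint_compl_left.mono_left (filter_subset _ _)
  rw [← card_preimage, preimage_eq, card_union_of_disjoint disjoint]
  simp

theorem card_sub_mul_mapsToProb_insert (J B : Finset α) {i : α} (hi : i ∉ J) :
    ((Fintype.card α : ℝ) - #J) * mapsToProb (insert i J) B = (#B - #J) * mapsToProb J B := by
  have forall_insert (j : α) : mapsToProb (insert j J) B = 𝔼 π : Perm α,
      (if π j ∈ B then (1 : ℝ) else 0) * if ∀ l ∈ J, π l ∈ B then 1 else 0 := by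
    simp only [mapsToProb, forall_mem_insert, ite_and, ite_mul, one_mul, zero_mul]
  calc ((Fintype.card α : ℝ) - #J) * mapsToProb (insert i J) B
      = ∑ j ∈ Jᶜ, mapsToProb (insert j J) B := by
        rw [sum_congr rfl fun j hj =>
          mapsToProb_insert_eq_mapsToProb_insert J B (mem_compl.1 hj) hi, sum_const,
          nsmul_eq_mul, card_compl, Nat.cast_sub (card_le_univ J)]
    _ = 𝔼 π : Perm α, (#{j ∈ Jᶜ | π j ∈ B} : ℝ) * if ∀ l ∈ J, π l ∈ B then 1 else 0 := by
        simp only [forall_insert, ← expect_sum_comm, ← sum_mul, sum_boole]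
    _ = (#B - #J) * mapsToProb J B := by
        rw [mapsToProb, mul_expect]
        refine expect_congr rfl fun π _ => ?_
        split_ifs with h
        · rw [card_filter_compl_apply_mem h]
        · simp

theorem mapsToProb_nonneg (J B : Finset α) : 0 ≤ mapsToProb J B :=
  expect_nonneg fun _ _ => by positivity

theorem mapsToProb_le (J B : Finset α) : mapsToProb J B ≤ ((#B : ℝ) / Fintype.card α) ^ #J := by
  induction J using Finset.induction_on with
  | empty => simp [mapsToProb]
  | insert i J hi ih =>
    have hJ : (#J : ℝ) < Fintype.card α := mod_cast card_lt_univ_of_notMem hi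
    have hB : (#B : ℝ) ≤ Fintype.card α := mod_cast card_le_univ B
    have hα : (0 : ℝ) < Fintype.card α := (Nat.cast_nonneg _).trans_lt hJ
    have ratio_le : ((#B : ℝ) - #J) / (Fintype.card α - #J) ≤ #B / Fintype.card α := by
      rw [div_le_div_iff₀ (sub_pos.2 hJ) hα]
      nlinarith [mul_le_mul_of_nonneg_left hB (Nat.cast_nonneg (α := ℝ) #J)]
    calc mapsToProb (insert i J) B
        = (#B - #J) / (Fintype.card α - #J) * mapsToProb J B := by
          rw [div_mul_eq_mul_div, eq_div_iff (sub_pos.2 hJ).ne', mul_comm,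
            card_sub_mul_mapsToProb_insert J B hi]
      _ ≤ #B / Fintype.card α * mapsToProb J B :=
          mul_le_mul_of_nonneg_right ratio_le (mapsToProb_nonneg J B)
      _ ≤ #B / Fintype.card α * (#B / Fintype.card α) ^ #J :=
          mul_le_mul_of_nonneg_left ih (by positivity)
      _ = (#B / Fintype.card α) ^ #(insert i J) := by rw [card_insert_of_notMem hi, pow_succ']

/-- The number of elements of `A` that the permutation `π` maps into `B`. -/
def matched (π : Perm α) (A B : Finset α) : ℕ := #{i ∈ A | π i ∈ B}

theorem exp_mul_matched (π : Perm α) (A B : Finset α) (l : ℝ) :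
    exp (l * matched π A B) =
      ∑ J ∈ A.powerset, (exp l - 1) ^ #J * if ∀ i ∈ J, π i ∈ B then 1 else 0 := by
  calc exp (l * matched π A B)
      = ∏ i ∈ A, ((if π i ∈ B then exp l - 1 else 0) + 1) := by
        rw [mul_comm, Real.exp_nat_mul, matched, ← prod_const, prod_filter]
        refine prod_congr rfl fun i _ => ?_
        split_ifs <;> simp
    _ = _ := by simp only [prod_add_one, prod_ite_zero, prod_const, mul_ite, mul_one, mul_zero]

theorem expect_exp_mul_matched_le (A B : Finset α) {l : ℝ} (hl : 0 ≤ l) :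
    𝔼 π : Perm α, exp (l * matched π A B) ≤
      exp ((#A : ℝ) * #B / Fintype.card α * (exp l - 1)) := by
  have hl' : 0 ≤ exp l - 1 := sub_nonneg.2 (Real.one_le_exp hl)
  calc 𝔼 π : Perm α, exp (l * matched π A B)
      = ∑ J ∈ A.powerset, (exp l - 1) ^ #J * mapsToProb J B := by
        simp only [exp_mul_matched, expect_sum_comm, ← mul_expect, mapsToProb]
    _ ≤ ∑ J ∈ A.powerset, ((exp l - 1) * (#B / Fintype.card α)) ^ #J := by
        simp only [mul_pow]
        gcongr
        exact mapsToProb_le _ B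
    _ = ((exp l - 1) * (#B / Fintype.card α) + 1) ^ #A := by
        simp only [← prod_const, ← prod_add_one]
    _ ≤ exp ((exp l - 1) * (#B / Fintype.card α)) ^ #A := by
        gcongr
        exact Real.add_one_le_exp _
    _ = exp ((#A : ℝ) * #B / Fintype.card α * (exp l - 1)) := by
        rw [← Real.exp_nat_mul]
        congr 1
        ring

theorem expect_pi_prod {ι β : Type*} [Fintype ι] [DecidableEq ι] [Fintype β] (f : ι → β → ℝ) :
    𝔼 σ : ι → β, ∏ e, f e (σ e) = ∏ e, 𝔼 b, f e b := by
  simp only [Fintype.expect_eq_sum_div_card, prod_div_distrib, prod_univ_sum,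
    Fintype.piFinset_univ, Fintype.card_fun, Finset.prod_const, Finset.card_univ, Nat.cast_pow]

end RandomPermutation

section LogWeight

/-- The logarithmic weight `1 + log (k / a)` of a set of `a` out of `k` labels. It is set to `0` for
the empty set, so that empty sets do not contribute to weighted sums. -/
noncomputable def logWeight (k a : ℕ) : ℝ := if a = 0 then 0 else 1 + log (k / a)

theorem logWeight_zero (k : ℕ) : logWeight k 0 = 0 := if_pos rfl

theorem logWeight_of_ne_zero (k : ℕ) {a : ℕ} (ha : a ≠ 0) : logWeight k a = 1 + log (k / a) :=
  if_neg ha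

theorem one_le_logWeight {k a : ℕ} (ha : a ≠ 0) (hak : a ≤ k) : 1 ≤ logWeight k a := by
  have one_le_div : (1 : ℝ) ≤ k / a := (one_le_div (by positivity)).2 (mod_cast hak)
  rw [logWeight_of_ne_zero k ha]
  linarith [Real.log_nonneg one_le_div]

theorem logWeight_nonneg {k a : ℕ} (hak : a ≤ k) : 0 ≤ logWeight k a := by
  obtain rfl | ha := eq_or_ne a 0
  · exact (logWeight_zero k).ge
  · exact zero_le_one.trans (one_le_logWeight ha hak)

theorem exp_one_sub_logWeight {k a : ℕ} (hk : k ≠ 0) (ha : a ≠ 0) :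
    exp (1 - logWeight k a) = a / k := by
  rw [logWeight_of_ne_zero k ha, sub_add_cancel_left, ← Real.log_inv, inv_div,
    Real.exp_log (by positivity)]

theorem exp_sub_one_sub_le {l : ℝ} (hl : 0 ≤ l) : exp l - 1 - l ≤ l ^ 2 * exp l := by
  have exp_sub_one_le : exp l - 1 ≤ l * exp l := by
    have := mul_le_mul_of_nonneg_right (Real.one_sub_le_exp_neg l) (Real.exp_pos l).le
    rw [← Real.exp_add, neg_add_cancel, Real.exp_zero] at this
    linarith
  nlinarith [mul_le_mul_of_nonneg_left exp_sub_one_le hl]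

theorem mul_exp_neg_half_le (L : ℝ) : L * exp (-(L / 2)) ≤ 2 := by
  rw [Real.exp_neg, ← div_eq_mul_inv, div_le_iff₀ (Real.exp_pos _)]
  linarith [Real.add_one_le_exp (L / 2)]

theorem exp_one_sub_mul_exp_sub_le {κ L : ℝ} (hκ : 0 ≤ κ) (hκ' : κ ≤ 1 / 2) (hL : 0 ≤ L) :
    exp (1 - L) * (exp (κ * L) - 1 - κ * L) ≤ 6 * κ * (κ * L) := by
  have exp_mul_exp_le : exp (1 - L) * exp (κ * L) ≤ 3 * exp (-(L / 2)) := by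
    calc exp (1 - L) * exp (κ * L) ≤ exp 1 * exp (-(L / 2)) := by
          rw [← Real.exp_add, ← Real.exp_add, Real.exp_le_exp]
          nlinarith
      _ ≤ 3 * exp (-(L / 2)) := by
          gcongr
          linarith [Real.exp_one_lt_d9]
  calc exp (1 - L) * (exp (κ * L) - 1 - κ * L)
      ≤ exp (1 - L) * ((κ * L) ^ 2 * exp (κ * L)) :=
        mul_le_mul_of_nonneg_left (exp_sub_one_sub_le (by positivity)) (Real.exp_pos _).le
    _ = (κ * L) ^ 2 * (exp (1 - L) * exp (κ * L)) := by ring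
    _ ≤ (κ * L) ^ 2 * (3 * exp (-(L / 2))) :=
        mul_le_mul_of_nonneg_left exp_mul_exp_le (by positivity)
    _ = 3 * κ * (κ * L) * (L * exp (-(L / 2))) := by ring
    _ ≤ 3 * κ * (κ * L) * 2 := mul_le_mul_of_nonneg_left (mul_exp_neg_half_le L) (by positivity)
    _ = 6 * κ * (κ * L) := by ring

theorem div_mul_exp_logWeight_sub_le {k a : ℕ} (hak : a ≤ k) {κ : ℝ} (hκ : 0 ≤ κ)
    (hκ' : κ ≤ 1 / 2) :
    (a : ℝ) / k * (exp (κ * logWeight k a) - 1 - κ * logWeight k a) ≤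
      6 * κ * (κ * logWeight k a) := by
  obtain rfl | ha := eq_or_ne a 0
  · simp [logWeight_zero]
  · rw [← exp_one_sub_logWeight (by omega) ha]
    exact exp_one_sub_mul_exp_sub_le hκ hκ' (logWeight_nonneg hak)

theorem exp_neg_mul_logWeight_le_pow {k a : ℕ} (hak : a ≤ k) :
    exp (-(a * logWeight k a)) ≤ (1 / 2) ^ a := by
  obtain rfl | ha := eq_or_ne a 0
  · simp
  have exp_neg_one_le : exp (-1) ≤ 1 / 2 := by
    rw [Real.exp_neg, one_div]
    exact inv_anti₀ two_pos (by linarith [Real.exp_one_gt_d9])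
  calc exp (-(a * logWeight k a)) ≤ exp (a * (-1)) := by
        rw [Real.exp_le_exp]
        nlinarith [one_le_logWeight ha hak, Nat.cast_nonneg (α := ℝ) a]
    _ = exp (-1) ^ a := Real.exp_nat_mul _ _
    _ ≤ (1 / 2) ^ a := by gcongr

theorem choose_mul_exp_neg_mul_logWeight_le_one {k a : ℕ} (hak : a ≤ k) :
    (k.choose a : ℝ) * exp (-(a * logWeight k a)) ≤ 1 := by
  obtain rfl | ha := eq_or_ne a 0
  · simp
  have exp_neg_mul_logWeight : exp (-(a * logWeight k a)) = ((a : ℝ) / k) ^ a * exp (-a) := by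
    rw [← exp_one_sub_logWeight (by omega) ha, ← Real.exp_nat_mul, ← Real.exp_add]
    congr 1
    ring
  have hk : (k : ℝ) ≠ 0 := mod_cast (by omega : k ≠ 0)
  calc (k.choose a : ℝ) * exp (-(a * logWeight k a))
      ≤ (k : ℝ) ^ a / a.factorial * (((a : ℝ) / k) ^ a * exp (-a)) := by
        rw [exp_neg_mul_logWeight]
        exact mul_le_mul_of_nonneg_right (Nat.choose_le_pow_div a k) (by positivity)
    _ = (a : ℝ) ^ a / a.factorial * exp (-a) := by
        rw [div_pow]
        field_simp
    _ ≤ exp a * exp (-a) :=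
        mul_le_mul_of_nonneg_right (Real.pow_div_factorial_le_exp _ (by positivity) a)
          (Real.exp_pos _).le
    _ = 1 := by rw [← Real.exp_add, add_neg_cancel, Real.exp_zero]

/-- The increment from `i` to `i + 1` of the reciprocal of the logarithmic weight. Weighting the
threshold sets `{i < m}` by these increments represents `(logWeight k m)⁻¹` as a sum. -/
noncomputable def levelWeight (k i : ℕ) : ℝ := (logWeight k (i + 1))⁻¹ - (logWeight k i)⁻¹

theorem levelWeight_nonneg {k i : ℕ} (hi : i < k) : 0 ≤ levelWeight k i := by
  rw [levelWeight, sub_nonneg]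
  obtain rfl | hi₀ := eq_or_ne i 0
  · simpa [logWeight_zero] using logWeight_nonneg hi
  refine inv_anti₀ (zero_lt_one.trans_le (one_le_logWeight i.succ_ne_zero hi)) ?_
  have hk : (0 : ℝ) < k := mod_cast (Nat.zero_le i).trans_lt hi
  rw [logWeight_of_ne_zero k i.succ_ne_zero, logWeight_of_ne_zero k hi₀]
  gcongr
  exact i.le_succ

theorem sum_levelWeight_mul_ite {k m : ℕ} (hm : m ≤ k) (c : ℝ) :
    ∑ i ∈ range k, levelWeight k i * (if i < m then c else 0) = (logWeight k m)⁻¹ * c := by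
  have filter_lt : {i ∈ range k | i < m} = range m := by
    ext i
    simp only [mem_filter, mem_range]
    omega
  simp only [mul_ite, mul_zero]
  rw [← sum_filter, filter_lt, ← sum_mul]
  simp only [levelWeight]
  rw [sum_range_sub fun i => (logWeight k i)⁻¹, logWeight_zero, inv_zero, sub_zero]

theorem sum_levelWeight_le_one (k : ℕ) : ∑ i ∈ range k, levelWeight k i ≤ 1 := by
  simp only [levelWeight]
  rw [sum_range_sub fun i => (logWeight k i)⁻¹, logWeight_zero, inv_zero, sub_zero]
  obtain rfl | hk := eq_or_ne k 0
  · simp [logWeight_zero]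
  · exact inv_le_one_of_one_le₀ (one_le_logWeight hk le_rfl)

end LogWeight

section Excess

variable {α : Type*} [Fintype α]

/-- An upper bound for the logarithm of the number of sets of the same size as `A`. -/
noncomputable def setEntropy (A : Finset α) : ℝ := #A * logWeight (Fintype.card α) #A

theorem setEntropy_empty : setEntropy (∅ : Finset α) = 0 := by simp [setEntropy]

theorem sum_exp_neg_two_mul_setEntropy_le :
    ∑ A : Finset α, exp (-(2 * setEntropy A)) ≤ 2 := by
  have choose_mul_exp_le : ∀ a ∈ range (Fintype.card α + 1), (Fintype.card α).choose a •
      exp (-(2 * (a * logWeight (Fintype.card α) a))) ≤ (1 / 2 : ℝ) ^ a := by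
    intro a ha
    have hak : a ≤ Fintype.card α := Nat.lt_succ_iff.1 (mem_range.1 ha)
    rw [two_mul, neg_add, Real.exp_add, nsmul_eq_mul, ← mul_assoc]
    exact (mul_le_mul (choose_mul_exp_neg_mul_logWeight_le_one hak)
      (exp_neg_mul_logWeight_le_pow hak) (Real.exp_pos _).le zero_le_one).trans_eq (one_mul _)
  calc ∑ A : Finset α, exp (-(2 * setEntropy A))
      = ∑ a ∈ range (Fintype.card α + 1), (Fintype.card α).choose a •
          exp (-(2 * (a * logWeight (Fintype.card α) a))) := by
        rw [← powerset_univ, ← Finset.card_univ]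
        exact sum_powerset_apply_card
          (fun a : ℕ => exp (-(2 * (a * logWeight #(univ : Finset α) a))))
    _ ≤ ∑ a ∈ range (Fintype.card α + 1), (1 / 2 : ℝ) ^ a := sum_le_sum choose_mul_exp_le
    _ ≤ ∑' a : ℕ, (1 / 2 : ℝ) ^ a :=
        summable_geometric_two.sum_le_tsum _ fun _ _ => by positivity
    _ = 2 := tsum_geometric_two

theorem min_card_le_card_univ (A B : Finset α) : min #A #B ≤ Fintype.card α :=
  (min_le_left _ _).trans (card_le_univ A)

/-- The weight with which the excess of the pair `A`, `B` (see `excess`) enters the exponential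
moment; it grows as the smaller set shrinks, since small sets have larger relative deviations. -/
noncomputable def pairWeight (δ : ℝ) (A B : Finset α) : ℝ :=
  δ / 12 * logWeight (Fintype.card α) (min #A #B)

theorem card_mul_card_div_mul_exp_pairWeight_sub_le {δ : ℝ} (hδ : 0 ≤ δ) (hδ' : δ ≤ 1)
    (A B : Finset α) :
    (#A : ℝ) * #B / Fintype.card α * (exp (pairWeight δ A B) - 1 - pairWeight δ A B) ≤
      pairWeight δ A B * (δ * ((#A + #B) / 2)) := by
  have card_mul_card : (#A : ℝ) * #B = ((min #A #B : ℕ) : ℝ) * max (#A : ℝ) #B := by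
    rw [Nat.cast_min, min_mul_max]
  have pairWeight_nonneg : 0 ≤ pairWeight δ A B :=
    mul_nonneg (by positivity) (logWeight_nonneg (min_card_le_card_univ A B))
  calc (#A : ℝ) * #B / Fintype.card α * (exp (pairWeight δ A B) - 1 - pairWeight δ A B)
      = max (#A : ℝ) #B * (((min #A #B : ℕ) : ℝ) / Fintype.card α *
          (exp (pairWeight δ A B) - 1 - pairWeight δ A B)) := by rw [card_mul_card]; ring
    _ ≤ max (#A : ℝ) #B * (6 * (δ / 12) * pairWeight δ A B) :=
        mul_le_mul_of_nonneg_left (div_mul_exp_logWeight_sub_le (min_card_le_card_univ A B)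
          (by positivity) (by linarith)) (by positivity)
    _ ≤ (#A + #B) * (6 * (δ / 12) * pairWeight δ A B) := by
        gcongr
        exact max_le_add_of_nonneg (by positivity) (by positivity)
    _ = pairWeight δ A B * (δ * ((#A + #B) / 2)) := by ring

variable [DecidableEq α]

/-- The amount by which the number of pairs in `A × B` matched by `π` exceeds `#A * #B / k`, its
expectation for a random permutation `π`, plus `δ` times the average size of the two sets. -/
noncomputable def excess (δ : ℝ) (π : Perm α) (A B : Finset α) : ℝ :=
  matched π A B - (#A : ℝ) * #B / Fintype.card α - δ * ((#A + #B) / 2)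

theorem expect_exp_pairWeight_mul_excess_le_one {δ : ℝ} (hδ : 0 ≤ δ) (hδ' : δ ≤ 1)
    (A B : Finset α) : 𝔼 π : Perm α, exp (pairWeight δ A B * excess δ π A B) ≤ 1 := by
  set l := pairWeight δ A B
  set μ := (#A : ℝ) * #B / Fintype.card α
  have l_nonneg : 0 ≤ l := mul_nonneg (by positivity) (logWeight_nonneg (min_card_le_card_univ A B))
  calc 𝔼 π : Perm α, exp (l * excess δ π A B)
      = exp (-(l * (μ + δ * ((#A + #B) / 2)))) * 𝔼 π : Perm α, exp (l * matched π A B) := by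
        rw [mul_expect]
        refine expect_congr rfl fun π _ => ?_
        rw [← Real.exp_add, excess]
        congr 1
        ring
    _ ≤ exp (-(l * (μ + δ * ((#A + #B) / 2)))) * exp (μ * (exp l - 1)) := by
        gcongr
        exact expect_exp_mul_matched_le A B l_nonneg
    _ ≤ 1 := by
        rw [← Real.exp_add, Real.exp_le_one_iff]
        linarith [card_mul_card_div_mul_exp_pairWeight_sub_le hδ hδ' A B]

end Excess

section Discrepancy

variable {α : Type*} [Fintype α]

/-- The set `A` if it has more than `i` elements, and the empty set otherwise. -/
def discardSmall (i : ℕ) (A : Finset α) : Finset α := if i < #A then A else ∅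

theorem sum_levelWeight_mul_setEntropy_discardSmall (A : Finset α) :
    ∑ i ∈ range (Fintype.card α), levelWeight (Fintype.card α) i * setEntropy (discardSmall i A) =
      #A := by
  simp only [discardSmall, apply_ite setEntropy, setEntropy_empty]
  rw [sum_levelWeight_mul_ite (card_le_univ A), setEntropy]
  obtain h | h := eq_or_ne #A 0
  · simp [h]
  · have : logWeight (Fintype.card α) #A ≠ 0 :=
      (zero_lt_one.trans_le (one_le_logWeight h (card_le_univ A))).ne'
    field_simp

variable [DecidableEq α]

theorem excess_nonpos_of_min_card_eq_zero {δ : ℝ} (hδ : 0 ≤ δ) (π : Perm α) {A B : Finset α}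
    (h : min #A #B = 0) : excess δ π A B ≤ 0 := by
  have matched_eq_zero : matched π A B = 0 := by
    obtain h | h := Nat.min_eq_zero_iff.1 h <;> simp [matched, card_eq_zero.1 h]
  rw [excess, matched_eq_zero, Nat.cast_zero, zero_sub, ← neg_add', neg_nonpos]
  positivity

theorem mul_excess_le_sum_levelWeight {δ : ℝ} (hδ : 0 ≤ δ) (π : Perm α) (A B : Finset α) :
    δ / 12 * excess δ π A B ≤
      ∑ i ∈ range (Fintype.card α), levelWeight (Fintype.card α) i *
        (pairWeight δ (discardSmall i A) (discardSmall i B) *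
          excess δ π (discardSmall i A) (discardSmall i B)) := by
  have discardSmall_eq (i : ℕ) : pairWeight δ (discardSmall i A) (discardSmall i B) *
      excess δ π (discardSmall i A) (discardSmall i B) =
        if i < min #A #B then pairWeight δ A B * excess δ π A B else 0 := by
    by_cases hA : i < #A <;> by_cases hB : i < #B <;>
      simp [discardSmall, pairWeight, logWeight_zero, hA, hB]
  simp only [discardSmall_eq]
  rw [sum_levelWeight_mul_ite (min_card_le_card_univ A B), pairWeight]
  obtain h | h := eq_or_ne (min #A #B) 0
  · rw [h, logWeight_zero, inv_zero, zero_mul]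
    exact mul_nonpos_of_nonneg_of_nonpos (by positivity) (excess_nonpos_of_min_card_eq_zero hδ π h)
  · have : logWeight (Fintype.card α) (min #A #B) ≠ 0 :=
      (zero_lt_one.trans_le (one_le_logWeight h (min_card_le_card_univ A B))).ne'
    refine le_of_eq ?_
    field_simp

variable {ι V : Type*} [Fintype ι]

/-- The total weighted excess, over the edges `s e - t e` of a multigraph on `V` carrying the
permutations `σ e`, of a family `S` of label sets. -/
noncomputable def weightedExcess (δ : ℝ) (s t : ι → V) (σ : ι → Perm α) (S : V → Finset α) : ℝ :=
  ∑ e, pairWeight δ (S (s e)) (S (t e)) * excess δ (σ e) (S (s e)) (S (t e))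

theorem expect_exp_weightedExcess_le_one [DecidableEq ι] {δ : ℝ} (hδ : 0 ≤ δ) (hδ' : δ ≤ 1)
    (s t : ι → V) (S : V → Finset α) : 𝔼 σ : ι → Perm α, exp (weightedExcess δ s t σ S) ≤ 1 := by
  simp only [weightedExcess, Real.exp_sum]
  rw [expect_pi_prod fun e π =>
    exp (pairWeight δ (S (s e)) (S (t e)) * excess δ π (S (s e)) (S (t e)))]
  exact prod_le_one (fun e _ => expect_nonneg fun π _ => (Real.exp_pos _).le) fun e _ =>
    expect_exp_pairWeight_mul_excess_le_one hδ hδ' _ _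

variable [Fintype V]

/-- The mixing property of the permutations `σ` used to bound the relaxation: for every family of
label sets, the number of matched pairs exceeds its mean, up to a `δ` fraction of the sizes, by at
most `O(1 / δ)` for every vertex and every chosen label. -/
def HasSmallDiscrepancy (s t : ι → V) (δ : ℝ) (σ : ι → Perm α) : Prop :=
  ∀ S : V → Finset α,
    ∑ e, excess δ (σ e) (S (s e)) (S (t e)) ≤ 24 / δ * (∑ u, #(S u) + Fintype.card V)

theorem hasSmallDiscrepancy_of_weightedExcess_le {δ : ℝ} (hδ : 0 < δ) {s t : ι → V}
    {σ : ι → Perm α} (h : ∀ S : V → Finset α,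
      weightedExcess δ s t σ S ≤ 2 * (∑ u, setEntropy (S u) + Fintype.card V)) :
    HasSmallDiscrepancy s t δ σ := by
  intro S
  set k := Fintype.card α
  have levelWeight_le : δ / 12 * ∑ e, excess δ (σ e) (S (s e)) (S (t e)) ≤
      2 * (∑ u, #(S u) + Fintype.card V) := by
    calc δ / 12 * ∑ e, excess δ (σ e) (S (s e)) (S (t e))
        ≤ ∑ i ∈ range k, levelWeight k i *
            weightedExcess δ s t σ fun u => discardSmall i (S u) := by
          simp only [weightedExcess, mul_sum]
          rw [sum_comm]
          gcongr with e
          exact (mul_excess_le_sum_levelWeight hδ.le _ _ _).trans_eq (by simp only [k])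
      _ ≤ ∑ i ∈ range k, levelWeight k i *
            (2 * (∑ u, setEntropy (discardSmall i (S u)) + Fintype.card V)) := by
          gcongr with i hi
          · exact levelWeight_nonneg (mem_range.1 hi)
          · exact h _
      _ = 2 * (∑ u, ∑ i ∈ range k, levelWeight k i * setEntropy (discardSmall i (S u)) +
            (∑ i ∈ range k, levelWeight k i) * Fintype.card V) := by
          rw [sum_comm, sum_mul, ← sum_add_distrib, mul_sum]
          simp only [mul_left_comm _ (2 : ℝ), mul_add, ← mul_sum]
      _ ≤ 2 * (∑ u, #(S u) + Fintype.card V) := by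
          simp only [k, sum_levelWeight_mul_setEntropy_discardSmall]
          push_cast
          gcongr
          exact mul_le_of_le_one_left (Nat.cast_nonneg _) (sum_levelWeight_le_one _)
  rw [div_mul_eq_mul_div, le_div_iff₀ hδ]
  linarith

open Classical in
theorem one_sub_exp_mul_sum_exp_le_ite_hasSmallDiscrepancy [DecidableEq V] {δ : ℝ} (hδ : 0 < δ)
    (s t : ι → V) (σ : ι → Perm α) :
    1 - exp (-(2 * Fintype.card V)) * ∑ S : V → Finset α,
        exp (weightedExcess δ s t σ S - 2 * ∑ u, setEntropy (S u)) ≤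
      if HasSmallDiscrepancy s t δ σ then 1 else 0 := by
  split_ifs with h
  · exact sub_le_self _ (by positivity)
  obtain ⟨S, hS⟩ : ∃ S : V → Finset α,
      2 * (∑ u, setEntropy (S u) + Fintype.card V) < weightedExcess δ s t σ S := by
    by_contra! hcon
    exact h (hasSmallDiscrepancy_of_weightedExcess_le hδ hcon)
  rw [sub_nonpos]
  calc 1 ≤ exp (-(2 * Fintype.card V)) *
        exp (weightedExcess δ s t σ S - 2 * ∑ u, setEntropy (S u)) := by
        rw [← Real.exp_add, Real.one_le_exp_iff]
        linarith
    _ ≤ _ := by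
        gcongr
        exact single_le_sum (f := fun S : V → Finset α =>
          exp (weightedExcess δ s t σ S - 2 * ∑ u, setEntropy (S u)))
          (fun _ _ => (Real.exp_pos _).le) (mem_univ S)

variable [DecidableEq ι]

theorem expect_sum_exp_weightedExcess_le [DecidableEq V] {δ : ℝ} (hδ : 0 ≤ δ) (hδ' : δ ≤ 1)
    (s t : ι → V) : 𝔼 σ : ι → Perm α, ∑ S : V → Finset α,
      exp (weightedExcess δ s t σ S - 2 * ∑ u, setEntropy (S u)) ≤ 2 ^ Fintype.card V := by
  calc 𝔼 σ : ι → Perm α, ∑ S : V → Finset α,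
        exp (weightedExcess δ s t σ S - 2 * ∑ u, setEntropy (S u))
      = ∑ S : V → Finset α, (𝔼 σ : ι → Perm α, exp (weightedExcess δ s t σ S)) *
          ∏ u, exp (-(2 * setEntropy (S u))) := by
        rw [expect_sum_comm]
        refine sum_congr rfl fun S _ => ?_
        rw [expect_mul]
        simp only [← Real.exp_sum, ← Real.exp_add, sum_neg_distrib, ← mul_sum, sub_eq_add_neg]
    _ ≤ ∑ S : V → Finset α, ∏ u, exp (-(2 * setEntropy (S u))) := by
        gcongr with S
        exact mul_le_of_le_one_left (by positivity) (expect_exp_weightedExcess_le_one hδ hδ' s t S)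
    _ = ∏ _u : V, ∑ A : Finset α, exp (-(2 * setEntropy A)) := by
        rw [prod_univ_sum, Fintype.piFinset_univ]
    _ ≤ ∏ _u : V, 2 := by
        gcongr
        exact sum_exp_neg_two_mul_setEntropy_le
    _ = 2 ^ Fintype.card V := by rw [Finset.prod_const, Finset.card_univ]

open Classical in
theorem one_sub_exp_le_expect_hasSmallDiscrepancy {δ : ℝ} (hδ : 0 < δ) (hδ' : δ ≤ 1)
    (s t : ι → V) : 1 - exp (-Fintype.card V) ≤
      𝔼 σ : ι → Perm α, if HasSmallDiscrepancy s t δ σ then (1 : ℝ) else 0 := by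
  have two_pow_le_exp : (2 : ℝ) ^ Fintype.card V ≤ exp (Fintype.card V) := by
    rw [← mul_one ((Fintype.card V : ℕ) : ℝ), Real.exp_nat_mul]
    gcongr
    linarith [Real.exp_one_gt_d9]
  calc 1 - exp (-Fintype.card V)
      = 1 - exp (-(2 * Fintype.card V)) * exp (Fintype.card V) := by
        rw [← Real.exp_add]
        ring_nf
    _ ≤ 1 - exp (-(2 * Fintype.card V)) * 𝔼 σ : ι → Perm α, ∑ S : V → Finset α,
          exp (weightedExcess δ s t σ S - 2 * ∑ u, setEntropy (S u)) := by
        gcongr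
        exact (expect_sum_exp_weightedExcess_le hδ.le hδ' s t).trans two_pow_le_exp
    _ = 𝔼 σ : ι → Perm α, (1 - exp (-(2 * Fintype.card V)) * ∑ S : V → Finset α,
          exp (weightedExcess δ s t σ S - 2 * ∑ u, setEntropy (S u))) := by
        rw [expect_sub_distrib, Fintype.expect_const, mul_expect]
    _ ≤ _ := expect_le_expect fun σ _ =>
        one_sub_exp_mul_sum_exp_le_ite_hasSmallDiscrepancy hδ s t σ

end Discrepancy

section LayerCake

open MeasureTheory

variable {α : Type*} [Fintype α]

/-- The superlevel set of `f` at the threshold `τ`, as a finset. -/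
noncomputable def superlevel (f : α → ℝ) (τ : ℝ) : Finset α := {i | τ ≤ f i}

theorem antitone_superlevel (f : α → ℝ) : Antitone (superlevel f) := fun _ _ h =>
  monotone_filter_right _ fun _ _ => h.trans

theorem intervalIntegrable_card_superlevel (f : α → ℝ) (a b : ℝ) :
    IntervalIntegrable (fun τ => (#(superlevel f τ) : ℝ)) volume a b :=
  Antitone.intervalIntegrable fun _ _ h => Nat.cast_le.2 (card_le_card (antitone_superlevel f h))

theorem integral_ite_le {c T : ℝ} (hc : 0 ≤ c) (hT : 0 ≤ T) :
    ∫ τ in 0..T, (if τ ≤ c then 1 else 0 : ℝ) = min c T := by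
  calc ∫ τ in 0..T, (if τ ≤ c then 1 else 0 : ℝ)
      = ∫ τ in 0..T, Set.indicator {τ | τ ≤ min c T} (fun _ => (1 : ℝ)) τ := by
        refine intervalIntegral.integral_congr fun τ hτ => ?_
        rw [Set.uIcc_of_le hT] at hτ
        simp [Set.indicator_apply, hτ.2]
    _ = min c T := by
        rw [intervalIntegral.integral_indicator ⟨le_min hc hT, min_le_right _ _⟩]
        simp

theorem integral_card_superlevel {f : α → ℝ} (hf : ∀ i, 0 ≤ f i) {T : ℝ} (hT : 0 ≤ T) :
    ∫ τ in 0..T, (#(superlevel f τ) : ℝ) = ∑ i, min (f i) T := by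
  have intervalIntegrable_ite (i : α) :
      IntervalIntegrable (fun τ => if τ ≤ f i then (1 : ℝ) else 0) volume 0 T := by
    refine Antitone.intervalIntegrable fun τ τ' h => ?_
    split_ifs <;> linarith
  simp only [superlevel, ← sum_boole]
  rw [intervalIntegral.integral_finsetSum fun i _ => intervalIntegrable_ite i]
  exact sum_congr rfl fun i _ => integral_ite_le (hf i) hT

theorem card_superlevel_mul_card_superlevel (f g : α → ℝ) (τ : ℝ) :
    (#(superlevel f τ) : ℝ) * #(superlevel g τ) =
      #(superlevel (fun p : α × α => min (f p.1) (g p.2)) τ) := by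
  rw [← Nat.cast_mul, ← card_product]
  congr 2
  ext p
  simp [superlevel]

variable [DecidableEq α]

theorem matched_superlevel (π : Perm α) (f g : α → ℝ) (τ : ℝ) :
    matched π (superlevel f τ) (superlevel g τ) =
      #(superlevel (fun i => min (f i) (g (π i))) τ) := by
  simp only [matched, superlevel, filter_filter, mem_filter, mem_univ, true_and, le_min_iff]

theorem excess_superlevel (δ : ℝ) (π : Perm α) (f g : α → ℝ) (τ : ℝ) :
    excess δ π (superlevel f τ) (superlevel g τ) =
      #(superlevel (fun i => min (f i) (g (π i))) τ) -
        #(superlevel (fun p : α × α => min (f p.1) (g p.2)) τ) * (Fintype.card α : ℝ)⁻¹ -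
        δ / 2 * (#(superlevel f τ) + #(superlevel g τ)) := by
  rw [excess, matched_superlevel, card_superlevel_mul_card_superlevel]
  ring

theorem intervalIntegrable_excess_superlevel (δ : ℝ) (π : Perm α) (f g : α → ℝ) (a b : ℝ) :
    IntervalIntegrable (fun τ => excess δ π (superlevel f τ) (superlevel g τ)) volume a b := by
  simp only [excess_superlevel]
  exact (((intervalIntegrable_card_superlevel _ a b).sub
    ((intervalIntegrable_card_superlevel _ a b).mul_const _)).sub
    (((intervalIntegrable_card_superlevel f a b).add
      (intervalIntegrable_card_superlevel g a b)).const_mul _))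

theorem integral_excess_superlevel (δ : ℝ) (π : Perm α) {f g : α → ℝ} (hf : ∀ i, 0 ≤ f i)
    (hg : ∀ i, 0 ≤ g i) {T : ℝ} (hT : 0 ≤ T) :
    ∫ τ in 0..T, excess δ π (superlevel f τ) (superlevel g τ) =
      ∑ i, min (min (f i) (g (π i))) T -
        (∑ i, ∑ j, min (min (f i) (g j)) T) * (Fintype.card α : ℝ)⁻¹ -
        δ / 2 * (∑ i, min (f i) T + ∑ i, min (g i) T) := by
  have integrable {β : Type _} [Fintype β] (h : β → ℝ) :=
    intervalIntegrable_card_superlevel h 0 T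
  simp only [excess_superlevel]
  rw [intervalIntegral.integral_sub ((integrable _).sub ((integrable _).mul_const _))
      (((integrable f).add (integrable g)).const_mul _),
    intervalIntegral.integral_sub (integrable _) ((integrable _).mul_const _),
    intervalIntegral.integral_mul_const, intervalIntegral.integral_const_mul,
    intervalIntegral.integral_add (integrable f) (integrable g),
    integral_card_superlevel (fun i => le_min (hf _) (hg _)) hT,
    integral_card_superlevel (fun p => le_min (hf _) (hg _)) hT,
    integral_card_superlevel hf hT, integral_card_superlevel hg hT, Fintype.sum_prod_type]

theorem min_sq_le_abs_mul_abs (a b T : ℝ) : min (min (a ^ 2) (b ^ 2)) T ≤ |a| * |b| := by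
  rw [← sq_abs a, ← sq_abs b]
  refine (min_le_left _ _).trans ?_
  obtain h | h := le_total |a| |b|
  · exact (min_le_left _ _).trans (by nlinarith [abs_nonneg a])
  · exact (min_le_right _ _).trans (by nlinarith [abs_nonneg b])

/-- The excess of a permutation on two real-valued functions in place of two sets: the squares of
the functions, truncated at `T`, replace the indicator functions of the sets. -/
noncomputable def truncatedExcess (δ T : ℝ) (π : Perm α) (y z : α → ℝ) : ℝ :=
  ∑ i, min (min (y i ^ 2) (z (π i) ^ 2)) T - (∑ i, |y i|) * (∑ i, |z i|) / Fintype.card α -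
    δ / 2 * (∑ i, y i ^ 2 + ∑ i, z i ^ 2)

theorem truncatedExcess_le_integral_excess {δ : ℝ} (hδ : 0 ≤ δ) (π : Perm α) (y z : α → ℝ) {T : ℝ}
    (hT : 0 ≤ T) :
    truncatedExcess δ T π y z ≤
      ∫ τ in 0..T, excess δ π (superlevel (y · ^ 2) τ) (superlevel (z · ^ 2) τ) := by
  rw [integral_excess_superlevel δ π (fun i => sq_nonneg (y i)) (fun i => sq_nonneg (z i)) hT,
    truncatedExcess, sum_mul_sum, div_eq_mul_inv]
  gcongr
  · exact min_sq_le_abs_mul_abs _ _ T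
  · exact min_le_left _ _
  · exact min_le_left _ _

variable {ι V : Type*} [Fintype ι] [Fintype V]

theorem HasSmallDiscrepancy.sum_truncatedExcess_le {s t : ι → V} {δ : ℝ} {σ : ι → Perm α}
    (h : HasSmallDiscrepancy s t δ σ) (hδ : 0 ≤ δ) {T : ℝ} (hT : 0 ≤ T) (y : V → α → ℝ) :
    ∑ e, truncatedExcess δ T (σ e) (y (s e)) (y (t e)) ≤
      24 / δ * (∑ u, ∑ i, y u i ^ 2 + Fintype.card V * T) := by
  have integrable_card (u : V) := intervalIntegrable_card_superlevel (y u · ^ 2) 0 T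
  have integrable_sum_card : IntervalIntegrable
      (fun τ => ∑ u, (#(superlevel (y u · ^ 2) τ) : ℝ)) volume 0 T :=
    by simpa only [sum_fn] using IntervalIntegrable.sum _ fun u _ => integrable_card u
  have integrable_excess (e : ι) :=
    intervalIntegrable_excess_superlevel δ (σ e) (y (s e) · ^ 2) (y (t e) · ^ 2) 0 T
  have integrable_sum_excess : IntervalIntegrable (fun τ => ∑ e,
      excess δ (σ e) (superlevel (y (s e) · ^ 2) τ) (superlevel (y (t e) · ^ 2) τ)) volume 0 T := by
    simpa only [sum_fn] using IntervalIntegrable.sum _ fun e _ => integrable_excess e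
  calc _ ≤ ∑ e, ∫ τ in 0..T,
          excess δ (σ e) (superlevel (y (s e) · ^ 2) τ) (superlevel (y (t e) · ^ 2) τ) :=
        sum_le_sum fun e _ => truncatedExcess_le_integral_excess hδ (σ e) _ _ hT
    _ = ∫ τ in 0..T, ∑ e,
          excess δ (σ e) (superlevel (y (s e) · ^ 2) τ) (superlevel (y (t e) · ^ 2) τ) :=
        (intervalIntegral.integral_finsetSum fun e _ => integrable_excess e).symm
    _ ≤ ∫ τ in 0..T, 24 / δ * (∑ u, (#(superlevel (y u · ^ 2) τ) : ℝ) + Fintype.card V) := by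
        refine intervalIntegral.integral_mono_on hT integrable_sum_excess
          ((integrable_sum_card.add intervalIntegrable_const).const_mul _) fun τ _ => ?_
        simpa only [Nat.cast_sum] using h fun u => superlevel (y u · ^ 2) τ
    _ = 24 / δ * (∑ u, ∑ i, min (y u i ^ 2) T + Fintype.card V * T) := by
        rw [intervalIntegral.integral_const_mul,
          intervalIntegral.integral_add integrable_sum_card intervalIntegrable_const,
          intervalIntegral.integral_finsetSum fun u _ => integrable_card u]
        simp only [integral_card_superlevel (fun i => sq_nonneg (y _ i)) hT,
          intervalIntegral.integral_const, smul_eq_mul, sub_zero, mul_comm T]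
    _ ≤ 24 / δ * (∑ u, ∑ i, y u i ^ 2 + Fintype.card V * T) := by
        gcongr
        exact min_le_left _ _

end LayerCake

section Gaussian

open MeasureTheory ProbabilityTheory

theorem integral_abs_pow_gaussianReal (n : ℕ) :
    ∫ x, |x| ^ n ∂(gaussianReal 0 1) =
      2 ^ ((n : ℝ) / 2) * Real.Gamma (((n : ℝ) + 1) / 2) / √Real.pi := by
  let f : ℝ → ℝ := fun y => (√(2 * Real.pi))⁻¹ * (y ^ (n : ℝ) * exp (-(1 / 2) * y ^ (2 : ℝ)))
  calc ∫ x, |x| ^ n ∂(gaussianReal 0 1)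
      = ∫ x, f |x| := by
        rw [integral_gaussianReal_eq_integral_smul one_ne_zero]
        refine integral_congr_ae (ae_of_all _ fun x => ?_)
        simp only [f, gaussianPDFReal, smul_eq_mul, Real.rpow_natCast, Real.rpow_two, sq_abs,
          sub_zero, NNReal.coe_one, mul_one]
        ring_nf
    _ = 2 * ((√(2 * Real.pi))⁻¹ *
          ((1 / 2) ^ (-((n : ℝ) + 1) / 2) * (1 / 2) * Real.Gamma (((n : ℝ) + 1) / 2))) := by
        rw [integral_comp_abs, integral_const_mul,
          integral_rpow_mul_exp_neg_mul_rpow two_pos (by linarith [n.cast_nonneg (α := ℝ)])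
            one_half_pos]
    _ = _ := by
        rw [Real.sqrt_mul two_pos.le, one_div, Real.inv_rpow two_pos.le, neg_div,
          Real.rpow_neg two_pos.le, inv_inv, add_div, Real.rpow_add two_pos,
          ← Real.sqrt_eq_rpow]
        field_simp

theorem integral_abs_gaussianReal : ∫ x, |x| ∂(gaussianReal 0 1) = √(2 / Real.pi) := by
  have := integral_abs_pow_gaussianReal 1
  norm_num [← Real.sqrt_eq_rpow] at this
  rw [this, Real.sqrt_div two_pos.le]

theorem integral_sq_gaussianReal : ∫ x, x ^ 2 ∂(gaussianReal 0 1) = 1 := by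
  have Gamma_value := Real.Gamma_nat_add_half 1
  have := integral_abs_pow_gaussianReal 2
  norm_num [Nat.doubleFactorial] at this Gamma_value
  rw [this, Gamma_value]
  field_simp

theorem integral_pow_four_gaussianReal : ∫ x, x ^ 4 ∂(gaussianReal 0 1) = 3 := by
  have Gamma_value := Real.Gamma_nat_add_half 2
  have := integral_abs_pow_gaussianReal 4
  norm_num [Nat.doubleFactorial, Even.pow_abs (n := 4) ⟨2, rfl⟩] at this Gamma_value
  rw [this, Gamma_value]
  field_simp

variable {E : Type*} [NormedAddCommGroup E] [InnerProductSpace ℝ E] [FiniteDimensional ℝ E]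
  [MeasurableSpace E] [BorelSpace E]

theorem map_inner_stdGaussian (a : E) :
    (stdGaussian E).map (inner ℝ a) = (gaussianReal 0 1).map (‖a‖ * ·) := by
  have h := IsGaussian.map_eq_gaussianReal (μ := stdGaussian E) (innerSL ℝ a)
  rw [integral_strongDual_stdGaussian, variance_dual_stdGaussian, innerSL_apply_norm] at h
  rw [gaussianReal_map_const_mul, mul_zero, mul_one, ← Real.toNNReal_of_nonneg]
  exact h

theorem integral_comp_inner_stdGaussian (a : E) {f : ℝ → ℝ} (hf : Continuous f) :
    ∫ g, f (inner ℝ a g) ∂(stdGaussian E) = ∫ x, f (‖a‖ * x) ∂(gaussianReal 0 1) := by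
  rw [← integral_map (φ := inner ℝ a) (by fun_prop) hf.aestronglyMeasurable,
    map_inner_stdGaussian, integral_map (by fun_prop) hf.aestronglyMeasurable]

theorem integral_inner_pow_stdGaussian (a : E) (n : ℕ) :
    ∫ g, inner ℝ a g ^ n ∂(stdGaussian E) = ‖a‖ ^ n * ∫ x, x ^ n ∂(gaussianReal 0 1) := by
  rw [integral_comp_inner_stdGaussian a (continuous_pow n)]
  simp only [mul_pow, integral_const_mul]

theorem integral_abs_inner_stdGaussian (a : E) :
    ∫ g, |inner ℝ a g| ∂(stdGaussian E) = ‖a‖ * √(2 / Real.pi) := by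
  rw [integral_comp_inner_stdGaussian a continuous_abs]
  simp only [abs_mul, abs_norm, integral_const_mul, integral_abs_gaussianReal]

theorem memLp_inner_stdGaussian (a : E) {p : ENNReal} (hp : p ≠ ⊤) :
    MemLp (fun g => inner ℝ a g) p (stdGaussian E) :=
  IsGaussian.memLp_dual (stdGaussian E) (innerSL ℝ a) p hp

theorem integrable_inner_pow_stdGaussian (a : E) {n : ℕ} (hn : n ≠ 0) :
    Integrable (fun g => inner ℝ a g ^ n) (stdGaussian E) := by
  have integrable_norm_pow :=
    (memLp_inner_stdGaussian a (ENNReal.natCast_ne_top n)).integrable_norm_pow hn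
  exact integrable_norm_pow.mono (by fun_prop) (ae_of_all _ fun g => by simp)

theorem integrable_abs_inner_mul_abs_inner_stdGaussian (a b : E) :
    Integrable (fun g => |inner ℝ a g| * |inner ℝ b g|) (stdGaussian E) :=
  (memLp_inner_stdGaussian (p := 2) a ENNReal.ofNat_ne_top).abs.integrable_mul
    (memLp_inner_stdGaussian (p := 2) b ENNReal.ofNat_ne_top).abs

theorem indepFun_inner_stdGaussian {a b : E} (hab : inner ℝ a b = 0) :
    IndepFun (fun g => inner ℝ a g) (fun g => inner ℝ b g) (stdGaussian E) := by
  have hasGaussianLaw_id : HasGaussianLaw (id : E → E) (stdGaussian E) :=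
    ⟨by simpa using isGaussian_stdGaussian⟩
  have hasGaussianLaw_prod :
      HasGaussianLaw (fun g : E => (inner ℝ a g, inner ℝ b g)) (stdGaussian E) :=
    hasGaussianLaw_id.map ((innerSL ℝ a).prod (innerSL ℝ b))
  refine hasGaussianLaw_prod.indepFun_of_covariance_eq_zero ?_
  rw [← covarianceBilin_apply_eq_cov IsGaussian.memLp_two_id, covarianceBilin_stdGaussian,
    innerSL_apply_apply, hab]

theorem integral_abs_inner_mul_abs_inner_stdGaussian {a b : E} (hab : inner ℝ a b = 0) :
    ∫ g, |inner ℝ a g| * |inner ℝ b g| ∂(stdGaussian E) = 2 / Real.pi * (‖a‖ * ‖b‖) := by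
  have indep : IndepFun (fun g => |inner ℝ a g|) (fun g => |inner ℝ b g|) (stdGaussian E) :=
    (indepFun_inner_stdGaussian hab).comp (φ := abs) (ψ := abs) (by fun_prop) (by fun_prop)
  rw [indep.integral_fun_mul_eq_mul_integral (by fun_prop) (by fun_prop),
    integral_abs_inner_stdGaussian, integral_abs_inner_stdGaussian, mul_mul_mul_comm,
    Real.mul_self_sqrt (by positivity), mul_comm]

variable {α : Type*} [Fintype α]

theorem integrable_sum_abs_inner_mul_sum_abs_inner_stdGaussian (x y : α → E) :
    Integrable (fun g => (∑ i, |inner ℝ (x i) g|) * ∑ i, |inner ℝ (y i) g|) (stdGaussian E) := by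
  simp only [sum_mul_sum]
  exact integrable_finsetSum _ fun i _ => integrable_finsetSum _ fun j _ =>
    integrable_abs_inner_mul_abs_inner_stdGaussian _ _

/-- For parallel vectors the factor `2 / π` would be missing. -/
theorem integral_sum_abs_inner_sq_stdGaussian_le {x : α → E}
    (orthogonal : ∀ i j, i ≠ j → inner ℝ (x i) (x j) = 0) :
    ∫ g, (∑ i, |inner ℝ (x i) g|) ^ 2 ∂(stdGaussian E) ≤
      (1 + 2 / Real.pi * Fintype.card α) * ∑ i, ‖x i‖ ^ 2 := by
  classical
  have integral_le (i j : α) : ∫ g, |inner ℝ (x i) g| * |inner ℝ (x j) g| ∂(stdGaussian E) ≤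
      (if i = j then ‖x i‖ ^ 2 else 0) + 2 / Real.pi * (‖x i‖ * ‖x j‖) := by
    split_ifs with hij
    · subst hij
      simp only [← sq, sq_abs, integral_inner_pow_stdGaussian, integral_sq_gaussianReal, mul_one]
      exact le_add_of_nonneg_right (by positivity)
    · rw [integral_abs_inner_mul_abs_inner_stdGaussian (orthogonal i j hij), zero_add]
  calc ∫ g, (∑ i, |inner ℝ (x i) g|) ^ 2 ∂(stdGaussian E)
      = ∑ i, ∑ j, ∫ g, |inner ℝ (x i) g| * |inner ℝ (x j) g| ∂(stdGaussian E) := by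
        simp only [sq, sum_mul_sum]
        rw [integral_finsetSum _ fun i _ => integrable_finsetSum _ fun j _ =>
          integrable_abs_inner_mul_abs_inner_stdGaussian _ _]
        exact sum_congr rfl fun i _ => integral_finsetSum _ fun j _ =>
          integrable_abs_inner_mul_abs_inner_stdGaussian _ _
    _ ≤ ∑ i, ∑ j, ((if i = j then ‖x i‖ ^ 2 else 0) + 2 / Real.pi * (‖x i‖ * ‖x j‖)) :=
        sum_le_sum fun i _ => sum_le_sum fun j _ => integral_le i j
    _ = ∑ i, ‖x i‖ ^ 2 + 2 / Real.pi * (∑ i, ‖x i‖) ^ 2 := by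
        rw [sq (∑ i, ‖x i‖), sum_mul_sum]
        simp [sum_add_distrib, mul_sum]
    _ ≤ ∑ i, ‖x i‖ ^ 2 + 2 / Real.pi * (Fintype.card α * ∑ i, ‖x i‖ ^ 2) := by
        gcongr
        exact sq_sum_le_card_mul_sum_sq
    _ = _ := by ring

end Gaussian

section Rounding

open MeasureTheory ProbabilityTheory

theorem sub_pow_four_div_le_min_sq {T : ℝ} (hT : 0 < T) (a b : ℝ) :
    7 / 16 * (a ^ 2 + b ^ 2) - 2 * (a - b) ^ 2 - a ^ 4 / (4 * T) ≤
      min (min (a ^ 2) (b ^ 2)) T := by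
  have sq_sub_le : a ^ 2 - T ≤ a ^ 4 / (4 * T) := by
    rw [le_div_iff₀ (by positivity)]
    nlinarith [sq_nonneg (a ^ 2 - 2 * T)]
  have pow_four_nonneg : 0 ≤ a ^ 4 / (4 * T) := by positivity
  refine le_min (le_min ?_ ?_) ?_
  · nlinarith [sq_nonneg (9 * a - 7 * b), sq_nonneg (a - b)]
  · nlinarith [sq_nonneg (7 * a - 9 * b), sq_nonneg (a - b)]
  · nlinarith [sq_nonneg (9 * a - 7 * b), sq_nonneg (a - b)]

variable {E : Type*} [NormedAddCommGroup E] [InnerProductSpace ℝ E] [FiniteDimensional ℝ E]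
  [MeasurableSpace E] [BorelSpace E]

theorem integrable_min_sq_inner_stdGaussian (a b : E) {T : ℝ} (hT : 0 ≤ T) :
    Integrable (fun g => min (min (inner ℝ a g ^ 2) (inner ℝ b g ^ 2)) T) (stdGaussian E) := by
  refine (integrable_inner_pow_stdGaussian a two_ne_zero).mono
    (Continuous.aestronglyMeasurable (by fun_prop)) (ae_of_all _ fun g => ?_)
  rw [Real.norm_of_nonneg (by positivity), Real.norm_of_nonneg (by positivity)]
  exact (min_le_left _ _).trans (min_le_left _ _)

theorem le_integral_min_sq_inner_stdGaussian (a b : E) {T : ℝ} (hT : 0 < T) :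
    7 / 16 * (‖a‖ ^ 2 + ‖b‖ ^ 2) - 2 * ‖a - b‖ ^ 2 - 3 * ‖a‖ ^ 4 / (4 * T) ≤
      ∫ g, min (min (inner ℝ a g ^ 2) (inner ℝ b g ^ 2)) T ∂(stdGaussian E) := by
  have integrable_sq (c : E) := integrable_inner_pow_stdGaussian c two_ne_zero
  have integrable_main := ((integrable_sq a).fun_add (integrable_sq b)).const_mul (7 / 16)
  have integrable_dist := (integrable_sq (a - b)).const_mul 2
  have integrable_tail :=
    (integrable_inner_pow_stdGaussian a four_ne_zero).div_const (4 * T)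
  calc _ = ∫ g, (7 / 16 * (inner ℝ a g ^ 2 + inner ℝ b g ^ 2) - 2 * inner ℝ (a - b) g ^ 2 -
          inner ℝ a g ^ 4 / (4 * T)) ∂(stdGaussian E) := by
        rw [integral_sub (by exact integrable_main.sub integrable_dist) integrable_tail,
          integral_sub integrable_main integrable_dist, integral_const_mul, integral_const_mul,
          integral_div, integral_add (integrable_sq a) (integrable_sq b)]
        simp only [integral_inner_pow_stdGaussian, integral_sq_gaussianReal,
          integral_pow_four_gaussianReal]
        ring
    _ ≤ _ := by
        refine integral_mono ((integrable_main.sub integrable_dist).sub integrable_tail)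
          (integrable_min_sq_inner_stdGaussian a b hT.le) fun g => ?_
        simpa only [inner_sub_left] using
          sub_pow_four_div_le_min_sq hT (inner ℝ a g) (inner ℝ b g)

variable {α : Type*} [Fintype α]

theorem le_integral_sum_min_sq_inner_stdGaussian {a b : α → E} (ha : ∑ i, ‖a i‖ ^ 2 = 1)
    (hb : ∑ i, ‖b i‖ ^ 2 = 1) {T : ℝ} (hT : 0 < T) :
    7 / 8 - 3 / (4 * T) - 2 * ∑ i, ‖a i - b i‖ ^ 2 ≤
      ∫ g, ∑ i, min (min (inner ℝ (a i) g ^ 2) (inner ℝ (b i) g ^ 2)) T ∂(stdGaussian E) := by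
  have norm_pow_four_le (i : α) : ‖a i‖ ^ 4 ≤ ‖a i‖ ^ 2 := by
    have norm_sq_le : ‖a i‖ ^ 2 ≤ 1 :=
      ha ▸ single_le_sum (fun j _ => sq_nonneg ‖a j‖) (mem_univ i)
    nlinarith [sq_nonneg ‖a i‖]
  rw [integral_finsetSum _ fun i _ => integrable_min_sq_inner_stdGaussian _ _ hT.le]
  calc 7 / 8 - 3 / (4 * T) - 2 * ∑ i, ‖a i - b i‖ ^ 2
      = 7 / 16 * (∑ i, ‖a i‖ ^ 2 + ∑ i, ‖b i‖ ^ 2) - 2 * ∑ i, ‖a i - b i‖ ^ 2 -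
          3 * (∑ i, ‖a i‖ ^ 2) / (4 * T) := by rw [ha, hb]; ring
    _ = ∑ i, (7 / 16 * (‖a i‖ ^ 2 + ‖b i‖ ^ 2) - 2 * ‖a i - b i‖ ^ 2 -
          3 * ‖a i‖ ^ 2 / (4 * T)) := by
        simp only [sum_sub_distrib, sum_add_distrib, ← mul_sum, ← sum_div]
    _ ≤ _ := sum_le_sum fun i _ => by
        refine le_trans ?_ (le_integral_min_sq_inner_stdGaussian (a i) (b i) hT)
        gcongr ?_ - 3 * ?_ / (4 * T)
        exact norm_pow_four_le i

theorem integral_sum_abs_inner_mul_sum_abs_inner_stdGaussian_le {x y : α → E}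
    (hx : ∑ i, ‖x i‖ ^ 2 = 1) (orthogonal_x : ∀ i j, i ≠ j → inner ℝ (x i) (x j) = 0)
    (hy : ∑ i, ‖y i‖ ^ 2 = 1) (orthogonal_y : ∀ i j, i ≠ j → inner ℝ (y i) (y j) = 0) :
    ∫ g, (∑ i, |inner ℝ (x i) g|) * ∑ i, |inner ℝ (y i) g| ∂(stdGaussian E) ≤
      1 + 2 / Real.pi * Fintype.card α := by
  have integrable_sq (z : α → E) :
      Integrable (fun g => (∑ i, |inner ℝ (z i) g|) ^ 2) (stdGaussian E) := by
    simpa only [sq] using integrable_sum_abs_inner_mul_sum_abs_inner_stdGaussian z z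
  have integral_sq_x_le := integral_sum_abs_inner_sq_stdGaussian_le orthogonal_x
  have integral_sq_y_le := integral_sum_abs_inner_sq_stdGaussian_le orthogonal_y
  rw [hx] at integral_sq_x_le
  rw [hy] at integral_sq_y_le
  calc _ ≤ ∫ g, ((∑ i, |inner ℝ (x i) g|) ^ 2 + (∑ i, |inner ℝ (y i) g|) ^ 2) / 2
          ∂(stdGaussian E) := by
        refine integral_mono (integrable_sum_abs_inner_mul_sum_abs_inner_stdGaussian x y)
          (((integrable_sq x).add (integrable_sq y)).div_const 2) fun g => ?_
        linarith [two_mul_le_add_sq (∑ i, |inner ℝ (x i) g|) (∑ i, |inner ℝ (y i) g|)]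
    _ ≤ _ := by
        rw [integral_div, integral_add (integrable_sq x) (integrable_sq y)]
        linarith

theorem integral_sum_inner_sq_stdGaussian (x : α → E) :
    ∫ g, ∑ i, inner ℝ (x i) g ^ 2 ∂(stdGaussian E) = ∑ i, ‖x i‖ ^ 2 := by
  rw [integral_finsetSum _ fun i _ => integrable_inner_pow_stdGaussian _ two_ne_zero]
  simp only [integral_inner_pow_stdGaussian, integral_sq_gaussianReal, mul_one]

theorem integrable_sum_inner_sq_stdGaussian (x : α → E) :
    Integrable (fun g => ∑ i, inner ℝ (x i) g ^ 2) (stdGaussian E) :=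
  integrable_finsetSum _ fun _ _ => integrable_inner_pow_stdGaussian _ two_ne_zero

theorem integrable_truncatedExcess_inner (δ : ℝ) {T : ℝ} (hT : 0 ≤ T) (π : Perm α) (x y : α → E) :
    Integrable (fun g => truncatedExcess δ T π (fun i => inner ℝ (x i) g)
      (fun i => inner ℝ (y i) g)) (stdGaussian E) :=
  ((integrable_finsetSum _ fun _ _ => integrable_min_sq_inner_stdGaussian _ _ hT).sub
    ((integrable_sum_abs_inner_mul_sum_abs_inner_stdGaussian x y).div_const _)).sub
    (((integrable_sum_inner_sq_stdGaussian x).add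
      (integrable_sum_inner_sq_stdGaussian y)).const_mul _)

theorem le_integral_truncatedExcess_inner (δ : ℝ) {T : ℝ} (hT : 0 < T) (π : Perm α) {x y : α → E}
    (hx : ∑ i, ‖x i‖ ^ 2 = 1) (orthogonal_x : ∀ i j, i ≠ j → inner ℝ (x i) (x j) = 0)
    (hy : ∑ i, ‖y i‖ ^ 2 = 1) (orthogonal_y : ∀ i j, i ≠ j → inner ℝ (y i) (y j) = 0) :
    7 / 8 - 3 / (4 * T) - 2 * ∑ i, ‖x i - y (π i)‖ ^ 2 -
        (1 + 2 / Real.pi * Fintype.card α) / Fintype.card α - δ ≤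
      ∫ g, truncatedExcess δ T π (fun i => inner ℝ (x i) g) (fun i => inner ℝ (y i) g)
        ∂(stdGaussian E) := by
  have integrable_min := integrable_finsetSum (univ : Finset α) fun i _ =>
    integrable_min_sq_inner_stdGaussian (x i) (y (π i)) hT.le
  have integrable_mul :=
    (integrable_sum_abs_inner_mul_sum_abs_inner_stdGaussian x y).div_const (Fintype.card α)
  have integrable_sq (z : α → E) := integrable_sum_inner_sq_stdGaussian z
  have le_integral_min :=
    le_integral_sum_min_sq_inner_stdGaussian hx ((Equiv.sum_comp π (‖y ·‖ ^ 2)).trans hy) hT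
  have integral_mul_le :=
    integral_sum_abs_inner_mul_sum_abs_inner_stdGaussian_le hx orthogonal_x hy orthogonal_y
  simp only [truncatedExcess]
  rw [integral_sub (by exact integrable_min.sub integrable_mul)
      (((integrable_sq x).fun_add (integrable_sq y)).const_mul _),
    integral_sub integrable_min integrable_mul, integral_div, integral_const_mul,
    integral_add (integrable_sq x) (integrable_sq y), integral_sum_inner_sq_stdGaussian,
    integral_sum_inner_sq_stdGaussian, hx, hy]
  have := div_le_div_of_nonneg_right integral_mul_le (Nat.cast_nonneg (α := ℝ) (Fintype.card α))
  linarith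

variable [DecidableEq α] {ι V : Type*} [Fintype ι] [Fintype V]

theorem HasSmallDiscrepancy.le_sum_sum_norm_sub_sq {s t : ι → V} {δ : ℝ} {σ : ι → Perm α}
    (h : HasSmallDiscrepancy s t δ σ) (hδ : 0 ≤ δ) {T : ℝ} (hT : 0 < T) {x : V → α → E}
    (sum_sq : ∀ u, ∑ i, ‖x u i‖ ^ 2 = 1)
    (orthogonal : ∀ u i j, i ≠ j → inner ℝ (x u i) (x u j) = 0) :
    (7 / 8 - 3 / (4 * T) - (1 + 2 / Real.pi * Fintype.card α) / Fintype.card α - δ) *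
        Fintype.card ι ≤
      2 * ∑ e, ∑ i, ‖x (s e) i - x (t e) (σ e i)‖ ^ 2 +
        24 / δ * (Fintype.card V * (1 + T)) := by
  have integrable_excess (e : ι) :=
    integrable_truncatedExcess_inner δ hT.le (σ e) (x (s e)) (x (t e))
  have integrable_sum_sq : Integrable (fun g => ∑ u, ∑ i, inner ℝ (x u i) g ^ 2) (stdGaussian E) :=
    integrable_finsetSum _ fun u _ => integrable_sum_inner_sq_stdGaussian (x u)
  have sum_integral_excess_le : ∑ e, ∫ g, truncatedExcess δ T (σ e) (fun i => inner ℝ (x (s e) i) g)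
      (fun i => inner ℝ (x (t e) i) g) ∂(stdGaussian E) ≤
        24 / δ * (Fintype.card V * (1 + T)) := by
    calc _ = ∫ g, ∑ e, truncatedExcess δ T (σ e) (fun i => inner ℝ (x (s e) i) g)
            (fun i => inner ℝ (x (t e) i) g) ∂(stdGaussian E) :=
          (integral_finsetSum _ fun e _ => integrable_excess e).symm
      _ ≤ ∫ g, 24 / δ * (∑ u, ∑ i, inner ℝ (x u i) g ^ 2 + Fintype.card V * T)
            ∂(stdGaussian E) :=
          integral_mono (integrable_finsetSum _ fun e _ => integrable_excess e)
            ((integrable_sum_sq.add (integrable_const _)).const_mul _) fun g =>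
            h.sum_truncatedExcess_le hδ hT.le fun u i => inner ℝ (x u i) g
      _ = _ := by
          rw [integral_const_mul, integral_add integrable_sum_sq (integrable_const _),
            integral_finsetSum _ fun u _ => integrable_sum_inner_sq_stdGaussian (x u)]
          simp [integral_sum_inner_sq_stdGaussian, sum_sq, mul_add]
  have le_sum_integral_excess := sum_le_sum fun e (_ : e ∈ univ) =>
    le_integral_truncatedExcess_inner δ hT (σ e) (sum_sq (s e)) (orthogonal (s e))
      (sum_sq (t e)) (orthogonal (t e))
  simp only [sum_sub_distrib, ← mul_sum, sum_const, card_univ, nsmul_eq_mul]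
    at le_sum_integral_excess
  linarith

end Rounding

/-- The constants leave room because `2 / π + 2 / 16 < 7 / 8`. -/
theorem HasSmallDiscrepancy.card_div_sixteen_le {α ι V E : Type*} [Fintype α] [DecidableEq α]
    [Fintype ι] [Fintype V] [NormedAddCommGroup E] [InnerProductSpace ℝ E] [FiniteDimensional ℝ E]
    {s t : ι → V} {σ : ι → Perm α}
    (h : HasSmallDiscrepancy s t (1 / 100) σ) (card_label : 100 ≤ Fintype.card α)
    (card_edge : 10 ^ 7 * Fintype.card V ≤ (Fintype.card ι : ℝ)) {x : V → α → E}
    (sum_sq : ∀ u, ∑ i, ‖x u i‖ ^ 2 = 1)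
    (orthogonal : ∀ u i j, i ≠ j → inner ℝ (x u i) (x u j) = 0) :
    (Fintype.card ι : ℝ) / 16 ≤ ∑ e, ∑ i, ‖x (s e) i - x (t e) (σ e i)‖ ^ 2 := by
  borelize E
  have rounding := h.le_sum_sum_norm_sub_sq (by norm_num) (show (0 : ℝ) < 75 by norm_num)
    sum_sq orthogonal
  have card_label_cast : (100 : ℝ) ≤ Fintype.card α := by exact_mod_cast card_label
  have mean_abs_le :
      (1 + 2 / Real.pi * Fintype.card α) / Fintype.card α ≤ 1 / 100 + 637 / 1000 := by
    rw [add_div, mul_div_cancel_right₀ _ (by positivity)]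
    refine add_le_add (one_div_le_one_div_of_le (by norm_num) card_label_cast) ?_
    rw [div_le_iff₀ Real.pi_pos]
    linarith [Real.pi_gt_d4]
  nlinarith [mul_le_mul_of_nonneg_right mean_abs_le (Nat.cast_nonneg (α := ℝ) (Fintype.card ι))]

namespace UniqueGame

variable {n k : ℕ} {E : Type*} [NormedAddCommGroup E] [InnerProductSpace ℝ E]

/-- The vectors of the integral solution of the standard SDP given by the assignment `a`. -/
noncomputable def integralVectors (a : Fin n → Fin k) (u : Fin n) (i : Fin k) :
    EuclideanSpace ℝ (Fin 1) :=
  if i = a u then EuclideanSpace.single 0 1 else 0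

theorem isSDPFeasible_integralVectors (a : Fin n → Fin k) :
    IsSDPFeasible (integralVectors a) where
  sum_sq u := by
    rw [sum_eq_single (a u)] <;> simp +contextual [integralVectors]
  orthogonal u i j hij := by
    unfold integralVectors
    split_ifs with hi hj
    · exact absurd (hi.trans hj.symm) hij
    all_goals simp
  nonneg u v i j _ := by
    unfold integralVectors
    split_ifs <;> simp
  triangle u v w i j l := by
    unfold integralVectors
    split_ifs <;> simp

theorem sum_norm_integralVectors_sub_sq_le (a : Fin n → Fin k) (u v : Fin n) (π : Perm (Fin k)) :
    ∑ i, ‖integralVectors a u i - integralVectors a v (π i)‖ ^ 2 ≤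
      if a v = π (a u) then 0 else 2 := by
  split_ifs with satisfied
  · refine (sum_eq_zero fun i _ => ?_).le
    simp [integralVectors, satisfied]
  · calc _ ≤ ∑ i, ((if i = a u then (1 : ℝ) else 0) + if π i = a v then 1 else 0) := by
          refine sum_le_sum fun i _ => ?_
          unfold integralVectors
          split_ifs <;> simp
      _ = 2 := by
          rw [sum_add_distrib, Equiv.sum_comp π fun i => if i = a v then (1 : ℝ) else 0]
          norm_num

theorem sdpObjective_nonneg (I : UniqueGame n k) (x : Fin n → Fin k → E) :
    0 ≤ I.sdpObjective x := by
  unfold sdpObjective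
  positivity

theorem sdpValue_le_sdpObjective (I : UniqueGame n k) {d : ℕ}
    {x : Fin n → Fin k → EuclideanSpace ℝ (Fin d)} (hx : IsSDPFeasible x) :
    I.sdpValue ≤ I.sdpObjective x := by
  refine csInf_le ⟨0, ?_⟩ ⟨d, x, hx, rfl⟩
  rintro _ ⟨d', y, _, rfl⟩
  exact I.sdpObjective_nonneg y

theorem sum_ite_satisfies (I : UniqueGame n k) [Fintype I.graph.edgeSet] (a : Fin n → Fin k)
    [DecidablePred (I.Satisfies a)] :
    ∑ e, (if I.Satisfies a e then (0 : ℝ) else 2) =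
      2 * (I.numEdges - ({e | I.Satisfies a e}.ncard : ℝ)) := by
  have card_edges : (I.numEdges : ℝ) = ∑ e : I.graph.edgeSet, 1 := by
    rw [numEdges, ← Nat.card_coe_set_eq, Nat.card_eq_fintype_card, Fintype.card_eq_sum_ones]
    push_cast
    rfl
  have card_satisfied : ({e | I.Satisfies a e}.ncard : ℝ) =
      ∑ e, if I.Satisfies a e then 1 else 0 := by
    rw [sum_boole, ← Set.ncard_coe_finset, coe_filter_univ]
  rw [card_edges, card_satisfied, ← sum_sub_distrib, mul_sum]
  exact sum_congr rfl fun e _ => by split_ifs <;> norm_num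

theorem sdpObjective_integralVectors_le (I : UniqueGame n k) (a : Fin n → Fin k) :
    I.sdpObjective (integralVectors a) ≤
      (I.numEdges - ({e | I.Satisfies a e}.ncard : ℝ)) / I.numEdges := by
  classical
  calc _ ≤ 1 / (2 * (I.numEdges : ℝ)) * ∑ e, if I.Satisfies a e then 0 else 2 := by
        unfold sdpObjective
        gcongr with e
        exact (sum_norm_integralVectors_sub_sq_le a _ _ _).trans_eq (if_congr Iff.rfl rfl rfl)
    _ = _ := by
        rw [sum_ite_satisfies, one_div_mul_eq_div, mul_div_mul_left _ _ two_ne_zero]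

theorem sdpValue_le_of_isSatisfiable (I : UniqueGame n k) {δ : ℝ} (hδ : 0 ≤ δ)
    (h : I.IsSatisfiable (1 - δ)) : I.sdpValue ≤ δ := by
  obtain ⟨a, ha⟩ := h
  calc I.sdpValue ≤ I.sdpObjective (integralVectors a) :=
        I.sdpValue_le_sdpObjective (isSDPFeasible_integralVectors a)
    _ ≤ (I.numEdges - ({e | I.Satisfies a e}.ncard : ℝ)) / I.numEdges :=
        I.sdpObjective_integralVectors_le a
    _ ≤ δ := div_le_of_le_mul₀ (Nat.cast_nonneg _) hδ (by linarith)

/-- The constraints of the basic SDP relaxation of Unique Games, that is, those of the standard SDP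
without the nonnegativity and triangle inequalities. -/
structure IsBasicSDPFeasible (x : Fin n → Fin k → E) : Prop where
  sum_sq : ∀ u, ∑ i, ‖x u i‖ ^ 2 = 1
  orthogonal : ∀ u i j, i ≠ j → inner ℝ (x u i) (x u j) = 0

theorem IsSDPFeasible.isBasicSDPFeasible {x : Fin n → Fin k → E} (hx : IsSDPFeasible x) :
    IsBasicSDPFeasible x :=
  ⟨hx.sum_sq, hx.orthogonal⟩

/-- The optimal value of the basic SDP, with the objective function and the convention on dimensions
of `sdpValue`. -/
noncomputable def basicSDPValue (I : UniqueGame n k) : ℝ :=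
  sInf {t | ∃ (d : ℕ) (x : Fin n → Fin k → EuclideanSpace ℝ (Fin d)),
    IsBasicSDPFeasible x ∧ t = I.sdpObjective x}

theorem basicSDPValue_le_sdpValue (I : UniqueGame n k) : I.basicSDPValue ≤ I.sdpValue := by
  obtain rfl | k_pos := k.eq_zero_or_pos
  · have basicSDPValue_nonpos : I.basicSDPValue ≤ 0 := by
      refine Real.sInf_nonpos ?_
      rintro _ ⟨d, x, _, rfl⟩
      simp [sdpObjective]
    refine basicSDPValue_nonpos.trans (Real.sInf_nonneg ?_)
    rintro _ ⟨d, x, _, rfl⟩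
    exact I.sdpObjective_nonneg x
  · refine csInf_le_csInf ⟨0, ?_⟩
      ⟨_, 1, _, isSDPFeasible_integralVectors fun _ => ⟨0, k_pos⟩, rfl⟩ ?_
    · rintro _ ⟨d, x, _, rfl⟩
      exact I.sdpObjective_nonneg x
    · rintro _ ⟨d, x, hx, rfl⟩
      exact ⟨d, x, hx.isBasicSDPFeasible, rfl⟩

theorem sum_corrupted_le_sdpObjective (I : UniqueGame n k) (F : Finset I.graph.edgeSet)
    (σ : F → Perm (Fin k)) (x : Fin n → Fin k → E) :
    1 / (2 * (I.numEdges : ℝ)) * ∑ e : F, ∑ i,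
        ‖x (e : Sym2 (Fin n)).inf i - x (e : Sym2 (Fin n)).sup (σ e i)‖ ^ 2 ≤
      (I.corrupt F σ).sdpObjective x := by
  classical
  let cost (e : I.graph.edgeSet) : ℝ := ∑ i : Fin k,
    ‖x (e : Sym2 (Fin n)).inf i - x (e : Sym2 (Fin n)).sup ((I.corrupt F σ).perm e i)‖ ^ 2
  have perm_corrupt (e : F) : (I.corrupt F σ).perm (e : I.graph.edgeSet) = σ e := by
    simp [corrupt]
  calc _ = 1 / (2 * (I.numEdges : ℝ)) * ∑ e ∈ F, cost e := by
        rw [← sum_coe_sort F cost]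
        simp only [cost, perm_corrupt]
    _ ≤ 1 / (2 * (I.numEdges : ℝ)) * ∑ e, cost e := by
        refine mul_le_mul_of_nonneg_left ?_ (by positivity)
        exact sum_le_univ_sum_of_nonneg fun e => sum_nonneg fun i _ => sq_nonneg _
    _ = _ := by
        unfold sdpObjective
        congr 1

theorem le_basicSDPValue_corrupt (I : UniqueGame n k) (F : Finset I.graph.edgeSet) {ε : ℝ}
    (hk : 100 ≤ k) (hE : 0 < I.numEdges) (hF : (#F : ℝ) = ε * I.numEdges)
    (card_edge : 10 ^ 7 * (n : ℝ) ≤ #F) {σ : F → Perm (Fin k)}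
    (hσ : HasSmallDiscrepancy (fun e : F => (e : Sym2 (Fin n)).inf)
      (fun e : F => (e : Sym2 (Fin n)).sup) (1 / 100) σ) :
    ε / 32 ≤ (I.corrupt F σ).basicSDPValue := by
  have : (0 : ℝ) < I.numEdges := Nat.cast_pos.2 hE
  refine le_csInf ⟨_, 1, _,
    (isSDPFeasible_integralVectors fun _ => ⟨0, by lia⟩).isBasicSDPFeasible, rfl⟩ ?_
  rintro _ ⟨d, x, hx, rfl⟩
  have card_div_sixteen_le := hσ.card_div_sixteen_le (by simpa using hk) (by simpa using card_edge)
    hx.sum_sq hx.orthogonal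
  rw [Fintype.card_coe] at card_div_sixteen_le
  calc ε / 32 = 1 / (2 * (I.numEdges : ℝ)) * (#F / 16) := by
        rw [hF]
        field_simp
        ring
    _ ≤ _ := mul_le_mul_of_nonneg_left card_div_sixteen_le (by positivity)
    _ ≤ _ := I.sum_corrupted_le_sdpObjective F σ x

open Classical in
theorem probCorrupt_eq_expect (I : UniqueGame n k) (F : Finset I.graph.edgeSet)
    (P : UniqueGame n k → Prop) :
    I.probCorrupt F P = 𝔼 σ, if P (I.corrupt F σ) then (1 : ℝ) else 0 := by
  rw [probCorrupt, PMF.toOuterMeasure_uniformOfFintype_apply, ENNReal.toReal_div,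
    ENNReal.toReal_natCast, ENNReal.toReal_natCast, Fintype.expect_eq_sum_div_card, sum_boole,
    Fintype.card_ofFinset]
  rfl

theorem expect_le_probCorrupt (I : UniqueGame n k) (F : Finset I.graph.edgeSet)
    {Q : (F → Perm (Fin k)) → Prop} [DecidablePred Q] {P : UniqueGame n k → Prop}
    (h : ∀ σ, Q σ → P (I.corrupt F σ)) :
    𝔼 σ, (if Q σ then (1 : ℝ) else 0) ≤ I.probCorrupt F P := by
  classical
  rw [probCorrupt_eq_expect]
  refine expect_le_expect fun σ _ => ?_
  split_ifs with hQ hP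
  exacts [le_rfl, absurd (h σ hQ) hP, zero_le_one, le_rfl]

theorem probCorrupt_mono (I : UniqueGame n k) (F : Finset I.graph.edgeSet)
    {P Q : UniqueGame n k → Prop} (h : ∀ J, P J → Q J) :
    I.probCorrupt F P ≤ I.probCorrupt F Q := by
  classical
  rw [probCorrupt_eq_expect]
  exact I.expect_le_probCorrupt F fun σ => h _

end UniqueGame

theorem mainTheorem8_general :
    (∃ (k₀ : ℕ) (C : ℝ) (η : ℕ → ℝ), 0 < C ∧ Tendsto η atTop (𝓝 0) ∧
      ∀ (n k : ℕ) (ε : ℝ), k₀ ≤ k → 0 < ε →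
        ∀ I : UniqueGame n k, C * n * ε⁻¹ ≤ I.numEdges →
          ∀ F : Finset I.graph.edgeSet, (#F : ℝ) = ε * I.numEdges →
            1 - η n ≤ I.probCorrupt F (fun J => ε / 32 ≤ J.basicSDPValue)) ∧
    (∀ (n k : ℕ) (δ : ℝ) (J : UniqueGame n k), 0 ≤ δ → J.IsSatisfiable (1 - δ) →
      J.sdpValue ≤ δ) := by
  classical
  refine ⟨⟨100, 10 ^ 7, fun n => exp (-n), by positivity,
    Real.tendsto_exp_neg_atTop_nhds_zero.comp tendsto_natCast_atTop_atTop,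
    fun n k ε hk hε I hE F hF => ?_⟩, fun n k δ J => J.sdpValue_le_of_isSatisfiable⟩
  obtain rfl | n_pos := n.eq_zero_or_pos
  · simp [UniqueGame.probCorrupt]
  have numEdges_pos : 0 < I.numEdges := by
    have : (0 : ℝ) < I.numEdges := lt_of_lt_of_le (by positivity) hE
    exact_mod_cast this
  have card_edge : 10 ^ 7 * (n : ℝ) ≤ #F := by
    rw [hF, mul_comm ε]
    rwa [← div_eq_mul_inv, div_le_iff₀ hε] at hE
  refine le_trans ?_ (I.expect_le_probCorrupt F fun σ =>
    I.le_basicSDPValue_corrupt F hk numEdges_pos hF card_edge)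
  simpa only [Fintype.card_fin] using one_sub_exp_le_expect_hasSmallDiscrepancy
    (δ := 1 / 100) (by norm_num) (by norm_num) (fun e : F => (e : Sym2 (Fin n)).inf)
      (fun e : F => (e : Sym2 (Fin n)).sup)

theorem mainTheorem8 :
    (∃ (k₀ : ℕ) (C : ℝ) (η : ℕ → ℝ), 0 < C ∧ Tendsto η atTop (𝓝 0) ∧
      ∀ (n k : ℕ) (ε : ℝ), k₀ ≤ k → 0 < ε → ε ≤ 1 →
        ∀ I : UniqueGame n k,
          C * (n : ℝ) * max ε⁻¹ (Real.log (k : ℝ)) ≤ (I.numEdges : ℝ) →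
          ∀ F : Finset I.graph.edgeSet, (F.card : ℝ) = ε * (I.numEdges : ℝ) →
            1 - η n ≤ I.probCorrupt F (fun J => ε / 32 ≤ J.sdpValue)) ∧
    (∀ (ε δ : ℝ), 0 ≤ δ → δ < ε / 32 →
      ∀ (n k : ℕ) (J : UniqueGame n k), J.IsSatisfiable (1 - δ) →
        J.sdpValue ≤ δ ∧ J.sdpValue < ε / 32) := by
  obtain ⟨⟨k₀, C, η, C_pos, tendsto_η, le_probCorrupt⟩, sdpValue_le⟩ := mainTheorem8_general
  refine ⟨⟨k₀, C, η, C_pos, tendsto_η, fun n k ε hk hε _ I hE F hF => ?_⟩, ?_⟩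
  · refine (le_probCorrupt n k ε hk hε I ?_ F hF).trans
      (I.probCorrupt_mono F fun J h => h.trans J.basicSDPValue_le_sdpValue)
    exact (mul_le_mul_of_nonneg_left (le_max_left _ _) (by positivity)).trans hE
  · exact fun ε δ hδ hδε n k J hJ =>
      ⟨sdpValue_le n k δ J hδ hJ, (sdpValue_le n k δ J hδ hJ).trans_lt hδε⟩
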